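/- Let $K$ be an imaginary quadratic field with an embedding $K\hookrightarrow\mathbb{C}$, and let $\mathcal{O}$ be an order in $K$, i.e. a subring of $K$ that is a finitely generated $\mathbb{Z}$-module and spans $K$ over $\mathbb{Q}$. Let $\mathfrak{a}$ be a proper fractional $\mathcal{O}$-ideal, i.e. a nonzero fractional $\mathcal{O}$-ideal with $\{\beta\in K:\beta\mathfrak{a}\subseteq\mathfrak{a}\}=\mathcal{O}$. For a lattice $L\subset\mathbb{C}$ put $$j(L)=1728\,\frac{g_2(L)^3}{g_2(L)^3-27g_3(L)^2},\qquad g_2(L)=60\sum_{\omega\in L\setminus\{0\}}\frac1{\omega^4},\qquad g_3(L)=140\sum_{\omega\in L\setminus\{0\}}\frac1{\omega^6},$$ and let $j(\mathfrak{a})$ be the $j$-invariant of the image of $\mathfrak{a}$ in $\mathbb{C}$. Let $\mathrm{Cl}(\mathcal{O})$ be the ideal class group of $\mathcal{O}$, i.e. the group of invertible fractional $\mathcal{O}$-ideals modulo the principal ones. Then $\mathfrak{a}$ is invertible, so that it has a class in $\mathrm{Cl}(\mathcal{O})$, and $j(\mathfrak{a})$ is a real number if and only if the class of $\mathfrak{a}$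 in $\mathrm{Cl}(\mathcal{O})$ has order at most $2$. -/

import Mathlib

open scoped nonZeroDivisors

noncomputable section

/-- `g₂(L) = 60 ∑_{ω ∈ L ∖ {0}} ω⁻⁴`, for a lattice `L` in `ℂ`. -/
def latticeG2 (L : AddSubgroup ℂ) : ℂ :=
  60 * ∑' ω : {ω : ℂ // ω ∈ L ∧ ω ≠ 0}, 1 / (ω : ℂ) ^ 4

/-- `g₃(L) = 140 ∑_{ω ∈ L ∖ {0}} ω⁻⁶`, for a lattice `L` in `ℂ`. -/
def latticeG3 (L : AddSubgroup ℂ) : ℂ :=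
  140 * ∑' ω : {ω : ℂ // ω ∈ L ∧ ω ≠ 0}, 1 / (ω : ℂ) ^ 6

/-- The `j`-invariant `j(L) = 1728 g₂(L)³ / (g₂(L)³ - 27 g₃(L)²)` of a lattice `L` in `ℂ`. -/
def latticeJ (L : AddSubgroup ℂ) : ℂ :=
  1728 * (latticeG2 L ^ 3 / (latticeG2 L ^ 3 - 27 * latticeG3 L ^ 2))

theorem tsum_lattice_ne_zero (L : AddSubgroup ℂ) (n : ℕ) (hn : n ≠ 0) :
    ∑' ω : {ω : ℂ // ω ∈ L ∧ ω ≠ 0}, 1 / (ω : ℂ) ^ n = ∑' ω : L, ((ω : ℂ) ^ n)⁻¹ := by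
  have h1 := tsum_subtype {ω : ℂ | ω ∈ L ∧ ω ≠ 0} (fun ω : ℂ => 1 / ω ^ n)
  have h2 := tsum_subtype (L : Set ℂ) (fun ω : ℂ => (ω ^ n)⁻¹)
  refine h1.trans (Eq.trans ?_ h2.symm)
  congr 1
  funext ω
  by_cases hL : ω ∈ L <;> by_cases h0 : ω = 0 <;> simp [Set.indicator, hL, h0, hn]

/-- For the lattice spanned by a pair of periods, `g₂` is the one of Mathlib. -/
theorem latticeG2_eq (P : PeriodPair) : latticeG2 P.lattice.toAddSubgroup = P.g₂ := by
  rw [latticeG2, tsum_lattice_ne_zero _ 4 (by norm_num), PeriodPair.g₂, PeriodPair.G]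
  rfl

/-- For the lattice spanned by a pair of periods, `g₃` is the one of Mathlib. -/
theorem latticeG3_eq (P : PeriodPair) : latticeG3 P.lattice.toAddSubgroup = P.g₃ := by
  rw [latticeG3, tsum_lattice_ne_zero _ 6 (by norm_num), PeriodPair.g₃, PeriodPair.G]
  rfl

/-- An order in a number field `K`: a subring of `K` (with `1`) which is a finitely generated
`ℤ`-module and which contains a `ℚ`-basis of `K`, that is, spans `K` over `ℚ`. -/
class IsNumberFieldOrder {K : Type*} [Field K] [NumberField K] (𝒪 : Subring K) : Prop where
  finite : Module.Finite ℤ 𝒪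
  span_eq_top : Submodule.span ℚ (𝒪 : Set K) = ⊤

theorem IsNumberFieldOrder.exists_nat_mul_mem {K : Type*} [Field K] [NumberField K]
    (𝒪 : Subring K) [h : IsNumberFieldOrder 𝒪] (x : K) :
    ∃ n : ℕ, n ≠ 0 ∧ (n : K) * x ∈ 𝒪 := by
  have hx : x ∈ Submodule.span ℚ (𝒪 : Set K) := by rw [h.span_eq_top]; trivial
  induction hx using Submodule.span_induction with
  | mem x hx => exact ⟨1, one_ne_zero, by simpa using hx⟩
  | zero => exact ⟨1, one_ne_zero, by simp⟩
  | add x y _ _ ihx ihy =>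
    obtain ⟨m, hm, hm'⟩ := ihx
    obtain ⟨n, hn, hn'⟩ := ihy
    refine ⟨m * n, mul_ne_zero hm hn, ?_⟩
    have := 𝒪.add_mem (𝒪.mul_mem (natCast_mem 𝒪 n) hm') (𝒪.mul_mem (natCast_mem 𝒪 m) hn')
    convert this using 1
    push_cast
    ring
  | smul a x _ ih =>
    obtain ⟨n, hn, hn'⟩ := ih
    refine ⟨a.den * n, mul_ne_zero a.den_nz hn, ?_⟩
    have := 𝒪.mul_mem (intCast_mem 𝒪 a.num) hn'
    convert this using 1
    have ha : (a.den : K) * (a : K) = (a.num : K) := by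
      exact_mod_cast congrArg (fun q : ℚ => (q : K)) (Rat.den_mul_eq_num a)
    rw [Algebra.smul_def, eq_ratCast, ← ha]
    push_cast
    ring

/-- The field `K` is the field of fractions of each of its orders. -/
instance IsNumberFieldOrder.isFractionRing {K : Type*} [Field K] [NumberField K]
    (𝒪 : Subring K) [IsNumberFieldOrder 𝒪] : IsFractionRing 𝒪 K := by
  refine IsFractionRing.of_field 𝒪 K fun z => ?_
  obtain ⟨n, hn, hz⟩ := IsNumberFieldOrder.exists_nat_mul_mem 𝒪 z
  refine ⟨⟨n * z, hz⟩, (n : 𝒪), ?_⟩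
  have hn' : (n : K) ≠ 0 := Nat.cast_ne_zero.mpr hn
  have h1 : algebraMap 𝒪 K ⟨n * z, hz⟩ = n * z := rfl
  rw [h1, map_natCast]
  field_simp

/-- A nonzero fractional `𝒪`-ideal `𝔞` is proper if `{β ∈ K : β 𝔞 ⊆ 𝔞}` is exactly `𝒪`. -/
def IsProperFractionalIdeal {K : Type*} [Field K] {𝒪 : Subring K}
    (𝔞 : FractionalIdeal 𝒪⁰ K) : Prop :=
  𝔞 ≠ 0 ∧ {β : K | ∀ x ∈ 𝔞, β * x ∈ 𝔞} = (𝒪 : Set K)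

/-- The image in `ℂ` of a fractional ideal `𝔞` under an embedding `φ` of the field. -/
def idealLattice {K : Type*} [Field K] {𝒪 : Subring K} (φ : K →+* ℂ)
    (𝔞 : FractionalIdeal 𝒪⁰ K) : AddSubgroup ℂ :=
  (𝔞 : Submodule 𝒪 K).toAddSubgroup.map φ.toAddMonoidHom

end

/-! Write 𝔞̄ for the complex conjugate of 𝔞. Since j(L̄) is the conjugate of j(L), and lattices with
equal j are homothetic, j(𝔞) is real iff the lattices of 𝔞 and 𝔞̄ are homothetic. The factor then
lies in K, so this says 𝔞̄ = y𝔞 with y ∈ Kˣ (`idealLattice_homothetic_conj_iff`). For proper 𝔞 the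
product 𝔞𝔞̄ is principal (`exists_conj_ideal_mul_eq_spanSingleton`); hence 𝔞 is invertible, 𝔞̄
represents the inverse class, and the condition becomes [𝔞] = [𝔞]⁻¹.

The analytic input is that j determines a lattice up to homothety (`exists_scale_of_latticeJ_eq`).
Equal j allows a rescaling after which g₂ and g₃ agree; then ℘'² = 4℘³ - g₂℘ - g₃ determines ℘ near
0, and the lattice is the set of poles of ℘. That g₂³ - 27g₃² ≠ 0 follows from the distinctness of
the three values of ℘ at the half periods, because (℘, ℘') separates points mod L. Both uniqueness
arguments compare orders of vanishing in an equation for a difference of two solutions. -/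

/-! ### Local uniqueness for analytic differential equations -/

open Filter Topology in
/-- A function analytic at `0` satisfying `z d' A = d B`, where no order of vanishing is compatible
with the leading terms, vanishes near `0`. -/
theorem AnalyticAt.eventually_eq_zero_of_mul_deriv_eq {d A B : ℂ → ℂ} (hd : AnalyticAt ℂ d 0)
    (hA : ContinuousAt A 0) (hB : ContinuousAt B 0) (hAB : ∀ n : ℕ, n * A 0 ≠ B 0)
    (h : ∀ᶠ z in 𝓝[≠] 0, z * deriv d z * A z = d z * B z) : ∀ᶠ z in 𝓝 0, d z = 0 := by
  by_contra hne
  have htop : analyticOrderAt d 0 ≠ ⊤ := fun ht => hne (analyticOrderAt_eq_top.1 ht)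
  obtain ⟨e, he, he0, hde⟩ := hd.analyticOrderAt_ne_top.1 htop
  set n := analyticOrderNatAt d 0
  simp only [sub_zero, smul_eq_mul] at hde
  have hder : ∀ᶠ z in 𝓝[≠] (0 : ℂ), (n * e z + z * deriv e z) * A z = e z * B z := by
    have h1 := hde.eventually_nhds.filter_mono (nhdsWithin_le_nhds (s := {0}ᶜ))
    have h2 := he.eventually_analyticAt.filter_mono (nhdsWithin_le_nhds (s := {0}ᶜ))
    filter_upwards [h, h1, h2, self_mem_nhdsWithin] with z hz hz1 hz2 hz0
    have hz0' : z ≠ 0 := hz0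
    have hd' : deriv d z = n * z ^ (n - 1) * e z + z ^ n * deriv e z := by
      rw [EventuallyEq.deriv_eq hz1, deriv_fun_mul (by fun_prop) hz2.differentiableAt]
      simp
    rw [hd', hz1.self_of_nhds] at hz
    have hp : (z * z ^ (n - 1)) * n = z ^ n * n := by
      rcases Nat.eq_zero_or_pos n with h0 | h0
      · simp [h0]
      · rw [mul_pow_sub_one h0.ne']
    apply mul_left_cancel₀ (pow_ne_zero n hz0')
    linear_combination hz - hp * e z * A z
  have hc1 : ContinuousAt (fun z => (n * e z + z * deriv e z) * A z) 0 := by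
    have := he.continuousAt
    have := he.deriv.continuousAt
    fun_prop
  have hc2 : ContinuousAt (fun z => e z * B z) 0 := he.continuousAt.mul hB
  -- Letting z → 0 leaves n e(0) A(0) = e(0) B(0), where n is the order of vanishing and e(0) ≠ 0.
  have := tendsto_nhds_unique_of_eventuallyEq (hc1.tendsto.mono_left nhdsWithin_le_nhds)
    (hc2.tendsto.mono_left nhdsWithin_le_nhds) hder
  simp only [zero_mul, add_zero] at this
  apply hAB n
  apply mul_left_cancel₀ he0
  linear_combination this

-- A finite order n of d at x would be at least 2, so d'' would have order n - 2, whereas c d has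
-- order at least n.
open Filter Topology in
theorem AnalyticAt.eventually_eq_zero_of_deriv_deriv_eq_mul {d c : ℂ → ℂ} {x : ℂ}
    (hd : AnalyticAt ℂ d x) (hc : AnalyticAt ℂ c x) (h0 : d x = 0) (h1 : deriv d x = 0)
    (h : ∀ᶠ z in 𝓝 x, deriv (deriv d) z = c z * d z) : ∀ᶠ z in 𝓝 x, d z = 0 := by
  rw [← analyticOrderAt_eq_top]
  have e1 := hd.analyticOrderAt_deriv_add_one
  have e2 := hd.deriv.analyticOrderAt_deriv_add_one
  simp only [h0, h1, sub_zero] at e1 e2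
  rw [analyticOrderAt_congr h] at e2
  have e3 : analyticOrderAt (fun z => c z * d z) x = analyticOrderAt c x + analyticOrderAt d x :=
    analyticOrderAt_mul hc hd
  rw [e3] at e2
  rw [← e2] at e1
  generalize analyticOrderAt c x = m at e1
  generalize analyticOrderAt d x = n at e1
  induction n using ENat.recTopCoe with
  | top => rfl
  | coe n =>
    induction m using ENat.recTopCoe with
    | top => simp at e1
    | coe m =>
      norm_cast at e1
      omega

/-! ### The Weierstrass function, the discriminant, and recovery of the lattice -/

namespace PeriodPair

open Filter Topology

variable (L : PeriodPair)

theorem countable_lattice : (L.lattice : Set ℂ).Countable := by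
  have : Countable L.lattice := L.latticeEquivProd.toEquiv.countable_iff.2 inferInstance
  exact Set.countable_coe_iff.1 this

theorem not_weierstrassP_eventuallyEq_of_analyticAt {f : ℂ → ℂ} {l : ℂ} (hl : l ∈ L.lattice)
    (hf : AnalyticAt ℂ f l) : ¬ L.weierstrassP =ᶠ[𝓝[≠] l] f := by
  intro h
  have h1 := L.order_weierstrassP l hl
  rw [meromorphicOrderAt_congr h] at h1
  have h2 := hf.meromorphicOrderAt_nonneg
  rw [h1] at h2
  exact absurd h2 (by decide)

/-- The identity theorem applies because removing a countable set from the plane leaves it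
connected. -/
theorem eqOn_compl_of_eventuallyEq {S : Set ℂ} (hS : S.Countable) {f g : ℂ → ℂ}
    (hf : AnalyticOnNhd ℂ f Sᶜ) (hg : AnalyticOnNhd ℂ g Sᶜ) {x : ℂ} (hx : x ∉ S)
    (h : f =ᶠ[𝓝 x] g) : Set.EqOn f g Sᶜ := by
  refine hf.eqOn_of_preconnected_of_eventuallyEq hg ?_ hx h
  refine (hS.isPathConnected_compl_of_one_lt_rank ?_).isConnected.isPreconnected
  rw [Complex.rank_real_complex]
  exact Cardinal.one_lt_two

theorem eventually_notMem_lattice (x : ℂ) : ∀ᶠ z in 𝓝[≠] x, z ∉ L.lattice := by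
  filter_upwards [self_mem_nhdsWithin, nhdsWithin_le_nhds
    (L.compl_lattice_sdiff_singleton_mem_nhds x)] with z hz hz' hzL
  exact hz' ⟨hzL, hz⟩

theorem eventually_notMem_lattice_of_notMem {x : ℂ} (hx : x ∉ L.lattice) :
    ∀ᶠ z in 𝓝 x, z ∉ L.lattice :=
  L.isClosed_lattice.isOpen_compl.mem_nhds hx

theorem not_derivWeierstrassP_eventually_eq_zero {x : ℂ} (hx : x ∉ L.lattice) :
    ¬ ∀ᶠ z in 𝓝 x, L.derivWeierstrassP z = 0 := by
  intro h
  have h2 : L.weierstrassP =ᶠ[𝓝 x] fun _ => L.weierstrassP x := by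
    have h3 : ∀ᶠ z in 𝓝 x, DifferentiableAt ℂ L.weierstrassP z := by
      filter_upwards [(L.analyticOnNhd_weierstrassP x hx).eventually_analyticAt] with z hz
      exact hz.differentiableAt
    obtain ⟨r, hr, hb⟩ := Metric.eventually_nhds_iff_ball.1 (h.and h3)
    filter_upwards [Metric.ball_mem_nhds x hr] with z hz
    exact Metric.isOpen_ball.is_const_of_deriv_eq_zero
      (convex_ball x r).isPreconnected
      (fun w hw => (hb w hw).2.differentiableWithinAt)
      (fun w hw => by rw [deriv_weierstrassP]; exact (hb w hw).1) hz (Metric.mem_ball_self hr)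
  have h4 := eqOn_compl_of_eventuallyEq L.countable_lattice L.analyticOnNhd_weierstrassP
    (fun _ _ => analyticAt_const) hx h2
  refine L.not_weierstrassP_eventuallyEq_of_analyticAt (zero_mem _)
    (analyticAt_const (v := L.weierstrassP x)) ?_
  filter_upwards [L.eventually_notMem_lattice 0] with z hz
  exact h4 hz

/-- `℘'' = 6 ℘² - g₂ / 2`. -/
theorem deriv_derivWeierstrassP {z : ℂ} (hz : z ∉ L.lattice) :
    deriv L.derivWeierstrassP z = 6 * L.weierstrassP z ^ 2 - L.g₂ / 2 := by
  -- Differentiating the equation for ℘'² yields the identity only up to a factor ℘', which is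
  -- cancelled because zeros of ℘' are isolated.
  have key : ∀ w ∉ L.lattice, L.derivWeierstrassP w * (deriv L.derivWeierstrassP w -
      (6 * L.weierstrassP w ^ 2 - L.g₂ / 2)) = 0 := by
    intro w hw
    have hp := (L.analyticOnNhd_weierstrassP w hw).differentiableAt.hasDerivAt
    have hp' := (L.analyticOnNhd_derivWeierstrassP w hw).differentiableAt.hasDerivAt
    rw [deriv_weierstrassP] at hp
    have h1 : (fun z => L.derivWeierstrassP z ^ 2) =ᶠ[𝓝 w]
        fun z => 4 * L.weierstrassP z ^ 3 - L.g₂ * L.weierstrassP z - L.g₃ := by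
      filter_upwards [L.eventually_notMem_lattice_of_notMem hw] with z hz
      exact L.derivWeierstrassP_sq z hz
    have h2 := h1.deriv_eq
    rw [(hp'.fun_pow 2).deriv,
      ((((hp.fun_pow 3).const_mul 4).fun_sub (hp.const_mul L.g₂)).sub_const L.g₃).deriv] at h2
    norm_num at h2
    linear_combination h2 / 2
  have ha' := L.analyticOnNhd_derivWeierstrassP z hz
  have ha : AnalyticAt ℂ (fun w => deriv L.derivWeierstrassP w -
      (6 * L.weierstrassP w ^ 2 - L.g₂ / 2)) z := by
    have := L.analyticOnNhd_weierstrassP z hz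
    have := ha'.deriv
    fun_prop
  rcases ha'.eventually_eq_zero_or_eventually_ne_zero with h | h
  · exact absurd h (L.not_derivWeierstrassP_eventually_eq_zero hz)
  rcases ha.eventually_eq_zero_or_eventually_ne_zero with h' | h'
  · exact sub_eq_zero.1 h'.self_of_nhds
  · obtain ⟨w, h1, h2, h3⟩ := (h.and (h'.and (nhdsWithin_le_nhds
      (L.eventually_notMem_lattice_of_notMem hz)))).exists
    exact absurd (key w h3) (mul_ne_zero h1 h2)

/-- The pair `(℘, ℘')` separates the points of `ℂ ∖ L` modulo `L`. -/
theorem sub_mem_lattice_of_weierstrassP_eq {x y : ℂ} (hx : x ∉ L.lattice) (hy : y ∉ L.lattice)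
    (h : L.weierstrassP x = L.weierstrassP y)
    (h' : L.derivWeierstrassP x = L.derivWeierstrassP y) : y - x ∈ L.lattice := by
  by_contra hxy
  set s := y - x with hs
  have hxs : x + s = y := by simp [hs]
  have hcont : Tendsto (fun z => z + s) (𝓝 x) (𝓝 y) := by
    rw [← hxs]; exact (continuous_add_const s).tendsto x
  have han : ∀ z, z + s ∉ L.lattice → AnalyticAt ℂ (fun z => L.weierstrassP (z + s)) z :=
    fun z hz => (L.analyticOnNhd_weierstrassP _ hz).comp_of_eq (by fun_prop) rfl
  have ha1 := L.analyticOnNhd_weierstrassP x hx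
  have ha2 := han x (by rwa [hxs])
  have hd1 : ∀ z, z ∉ L.lattice → z + s ∉ L.lattice →
      deriv (fun z => L.weierstrassP z - L.weierstrassP (z + s)) z =
        L.derivWeierstrassP z - L.derivWeierstrassP (z + s) := by
    intro z hz hzs
    rw [deriv_fun_sub (L.analyticOnNhd_weierstrassP z hz).differentiableAt
      (han z hzs).differentiableAt, deriv_comp_add_const, deriv_weierstrassP]
  have hev : ∀ᶠ z in 𝓝 x, z ∉ L.lattice ∧ z + s ∉ L.lattice :=
    (L.eventually_notMem_lattice_of_notMem hx).and
      (hcont.eventually (L.eventually_notMem_lattice_of_notMem hy))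
  -- By ℘'' = 6℘² - g₂/2, the difference d(z) = ℘(z) - ℘(z + s) solves d'' = 6(℘(z) + ℘(z + s)) d,
  -- with d(x) = d'(x) = 0.
  have hzero : ∀ᶠ z in 𝓝 x, L.weierstrassP z - L.weierstrassP (z + s) = 0 := by
    refine AnalyticAt.eventually_eq_zero_of_deriv_deriv_eq_mul
      (c := fun z => 6 * (L.weierstrassP z + L.weierstrassP (z + s))) (ha1.sub ha2) (by fun_prop)
      ?_ ?_ ?_
    · rw [hxs, h, sub_self]
    · rw [hd1 x hx (by rwa [hxs]), hxs, h', sub_self]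
    · filter_upwards [hev, hev.eventually_nhds] with z hz hz'
      have : deriv (fun z => L.weierstrassP z - L.weierstrassP (z + s)) =ᶠ[𝓝 z]
          fun z => L.derivWeierstrassP z - L.derivWeierstrassP (z + s) := by
        filter_upwards [hz'] with w hw
        exact hd1 w hw.1 hw.2
      have ha3 := (L.analyticOnNhd_derivWeierstrassP z hz.1).differentiableAt
      have ha4 : DifferentiableAt ℂ (fun z => L.derivWeierstrassP (z + s)) z :=
        ((L.analyticOnNhd_derivWeierstrassP _ hz.2).comp_of_eq
          (f := fun z => z + s) (by fun_prop) rfl).differentiableAt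
      rw [this.deriv_eq, deriv_fun_sub ha3 ha4, deriv_comp_add_const,
        L.deriv_derivWeierstrassP hz.1, L.deriv_derivWeierstrassP hz.2]
      ring
  set S : Set ℂ := L.lattice ∪ (fun z => z + s) ⁻¹' L.lattice
  have hS : S.Countable :=
    L.countable_lattice.union (L.countable_lattice.preimage (add_left_injective s))
  have heq := eqOn_compl_of_eventuallyEq hS (f := L.weierstrassP)
    (g := fun z => L.weierstrassP (z + s))
    (fun z hz => L.analyticOnNhd_weierstrassP z fun hzL => hz (Or.inl hzL))
    (fun z hz => han z fun hzL => hz (Or.inr hzL)) (x := x)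
    (by rintro (h1 | h1)
        · exact hx h1
        · exact hy (by simpa [hxs] using h1))
    (hzero.mono fun z hz => sub_eq_zero.1 hz)
  -- So s is a period of ℘; but at 0 the function ℘ has a pole, while ℘(z + s) is analytic as s ∉ L.
  refine L.not_weierstrassP_eventuallyEq_of_analyticAt (zero_mem _) (han 0 (by simpa)) ?_
  have : ∀ᶠ z in 𝓝 (0 : ℂ), z + s ∉ L.lattice := by
    have hc : Tendsto (fun z => z + s) (𝓝 0) (𝓝 s) := by
      simpa using (continuous_add_const s).tendsto 0
    exact hc.eventually (L.eventually_notMem_lattice_of_notMem hxy)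
  filter_upwards [L.eventually_notMem_lattice 0, nhdsWithin_le_nhds this] with z hz1 hz2
  exact heq fun hz => hz.elim hz1 hz2

/-- ℘' is odd and periodic, and x ≡ -x mod L. -/
theorem derivWeierstrassP_eq_zero_of_two_mul_mem {x : ℂ} (hx : 2 * x ∈ L.lattice) :
    L.derivWeierstrassP x = 0 := by
  have h1 := L.derivWeierstrassP_sub_coe x ⟨2 * x, hx⟩
  have h2 : x - 2 * x = -x := by ring
  simp only [h2, derivWeierstrassP_neg] at h1
  linear_combination (-1 / 2) * h1

/-- The discriminant of a lattice does not vanish. -/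
theorem g₂_pow_three_sub_ne_zero : L.g₂ ^ 3 - 27 * L.g₃ ^ 2 ≠ 0 := by
  have hmem : ∀ α β : ℚ, α.den ≠ 1 ∨ β.den ≠ 1 → (α * L.ω₁ + β * L.ω₂ : ℂ) ∉ L.lattice := by
    intro α β h h'
    rw [mul_ω₁_add_mul_ω₂_mem_lattice] at h'
    tauto
  have m1 : L.ω₁ / 2 ∉ L.lattice := L.ω₁_div_two_notMem_lattice
  have m2 : L.ω₂ / 2 ∉ L.lattice := L.ω₂_div_two_notMem_lattice
  have m3 : (L.ω₁ + L.ω₂) / 2 ∉ L.lattice := by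
    convert hmem (1 / 2) (1 / 2) (by norm_num) using 1
    push_cast; ring_nf
  have d1 := L.derivWeierstrassP_eq_zero_of_two_mul_mem (x := L.ω₁ / 2)
    (by rw [mul_div_cancel₀ _ two_ne_zero]; exact L.ω₁_mem_lattice)
  have d2 := L.derivWeierstrassP_eq_zero_of_two_mul_mem (x := L.ω₂ / 2)
    (by rw [mul_div_cancel₀ _ two_ne_zero]; exact L.ω₂_mem_lattice)
  have d3 := L.derivWeierstrassP_eq_zero_of_two_mul_mem (x := (L.ω₁ + L.ω₂) / 2)
    (by rw [mul_div_cancel₀ _ two_ne_zero]; exact add_mem L.ω₁_mem_lattice L.ω₂_mem_lattice)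
  have n12 : L.weierstrassP (L.ω₁ / 2) ≠ L.weierstrassP (L.ω₂ / 2) := fun h => by
    refine hmem (-1 / 2) (1 / 2) (by norm_num) ?_
    convert L.sub_mem_lattice_of_weierstrassP_eq m1 m2 h (d1.trans d2.symm) using 1
    push_cast; ring
  have n13 : L.weierstrassP (L.ω₁ / 2) ≠ L.weierstrassP ((L.ω₁ + L.ω₂) / 2) := fun h => by
    refine m2 ?_
    convert L.sub_mem_lattice_of_weierstrassP_eq m1 m3 h (d1.trans d3.symm) using 1
    ring
  have n23 : L.weierstrassP (L.ω₂ / 2) ≠ L.weierstrassP ((L.ω₁ + L.ω₂) / 2) := fun h => by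
    refine m1 ?_
    convert L.sub_mem_lattice_of_weierstrassP_eq m2 m3 h (d2.trans d3.symm) using 1
    ring
  have r1 := L.derivWeierstrassP_sq _ m1
  have r2 := L.derivWeierstrassP_sq _ m2
  have r3 := L.derivWeierstrassP_sq _ m3
  rw [d1] at r1
  rw [d2] at r2
  rw [d3] at r3
  generalize L.weierstrassP (L.ω₁ / 2) = e₁ at *
  generalize L.weierstrassP (L.ω₂ / 2) = e₂ at *
  generalize L.weierstrassP ((L.ω₁ + L.ω₂) / 2) = e₃ at *
  have n12' := sub_ne_zero.2 n12
  have n13' := sub_ne_zero.2 n13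
  have n23' := sub_ne_zero.2 n23
  -- The eᵢ are distinct roots of 4X³ - g₂X - g₃; dividing differences by eᵢ - eⱼ recovers Vieta's
  -- relations.
  have q12 : 4 * (e₁ ^ 2 + e₁ * e₂ + e₂ ^ 2) - L.g₂ = 0 := by
    apply mul_left_cancel₀ n12'
    linear_combination r2 - r1
  have q13 : 4 * (e₁ ^ 2 + e₁ * e₃ + e₃ ^ 2) - L.g₂ = 0 := by
    apply mul_left_cancel₀ n13'
    linear_combination r3 - r1
  have hsum : e₁ + e₂ + e₃ = 0 := by
    apply mul_left_cancel₀ n23'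
    linear_combination (q12 - q13) / 4
  have he3 : e₃ = -e₁ - e₂ := by linear_combination hsum
  have hg2 : L.g₂ = 4 * (e₁ ^ 2 + e₁ * e₂ + e₂ ^ 2) := by linear_combination -q12
  have hg3 : L.g₃ = 4 * e₁ ^ 3 - L.g₂ * e₁ := by linear_combination r1
  have hdisc : L.g₂ ^ 3 - 27 * L.g₃ ^ 2 =
      16 * ((e₁ - e₂) * (e₁ - e₃) * (e₂ - e₃)) ^ 2 := by
    rw [hg3, hg2, he3]; ring
  rw [hdisc]
  exact mul_ne_zero (by norm_num) (pow_ne_zero _ (mul_ne_zero (mul_ne_zero n12' n13') n23'))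

variable {L}

/-- The agreement spreads off both lattices, so a point of L outside M would be a pole of one side
only. -/
theorem lattice_le_of_weierstrassP_eventuallyEq {M : PeriodPair}
    (h : ∀ᶠ z in 𝓝[≠] 0, L.weierstrassP z = M.weierstrassP z) : L.lattice ≤ M.lattice := by
  intro l hl
  by_contra hlM
  have hev : ∀ᶠ z in 𝓝[≠] (0 : ℂ), ∀ᶠ w in 𝓝 z, L.weierstrassP w = M.weierstrassP w := by
    filter_upwards [eventually_eventually_nhdsWithin.2 h, self_mem_nhdsWithin] with z hz hz0
    rwa [isOpen_compl_singleton.nhdsWithin_eq hz0] at hz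
  obtain ⟨z, hz, hzL, hzM⟩ := (hev.and
    ((L.eventually_notMem_lattice 0).and (M.eventually_notMem_lattice 0))).exists
  have heq := eqOn_compl_of_eventuallyEq (S := L.lattice ∪ M.lattice)
    (L.countable_lattice.union M.countable_lattice)
    (L.analyticOnNhd_weierstrassP.mono (Set.compl_subset_compl.2 Set.subset_union_left))
    (M.analyticOnNhd_weierstrassP.mono (Set.compl_subset_compl.2 Set.subset_union_right))
    (x := z) (by rintro (h1 | h1) <;> contradiction) hz
  refine L.not_weierstrassP_eventuallyEq_of_analyticAt hl (M.analyticOnNhd_weierstrassP l hlM) ?_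
  filter_upwards [L.eventually_notMem_lattice l, M.eventually_notMem_lattice l] with w h1 h2
  exact heq (by rintro (h3 | h3) <;> contradiction)

theorem weierstrassP_eventuallyEq_of_g_eq {M : PeriodPair} (h2 : L.g₂ = M.g₂) (h3 : L.g₃ = M.g₃) :
    ∀ᶠ z in 𝓝[≠] 0, L.weierstrassP z = M.weierstrassP z := by
  set f₁ := L.weierstrassPExcept 0
  set f₂ := M.weierstrassPExcept 0
  have a1 : AnalyticAt ℂ f₁ 0 := L.analyticAt_weierstrassPExcept 0
  have a2 : AnalyticAt ℂ f₂ 0 := M.analyticAt_weierstrassPExcept 0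
  have p : ∀ (N : PeriodPair) (z : ℂ), N.weierstrassP z = N.weierstrassPExcept 0 z + 1 / z ^ 2 := by
    intro N z
    have := N.weierstrassPExcept_add 0 z
    rw [← this]; simp
  have p' : ∀ (N : PeriodPair) (z : ℂ),
      N.derivWeierstrassP z = N.derivWeierstrassPExcept 0 z - 2 / z ^ 3 := by
    intro N z
    have := N.derivWeierstrassPExcept_sub 0 z
    rw [← this]; simp
  have q : ∀ (N : PeriodPair), ∀ᶠ z in 𝓝[≠] (0 : ℂ),
      (z ^ 3 * deriv (N.weierstrassPExcept 0) z - 2) ^ 2 =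
        4 * (z ^ 2 * N.weierstrassPExcept 0 z + 1) ^ 3 -
          N.g₂ * z ^ 4 * (z ^ 2 * N.weierstrassPExcept 0 z + 1) - N.g₃ * z ^ 6 := by
    intro N
    filter_upwards [N.eventually_notMem_lattice 0, self_mem_nhdsWithin] with z hz hz0
    have hz0' : z ≠ 0 := hz0
    have := N.derivWeierstrassP_sq z hz
    rw [N.eqOn_deriv_weierstrassPExcept_derivWeierstrassPExcept 0 (x := z) (by simp [hz])]
    rw [p, p'] at this
    field_simp at this
    linear_combination this
  -- With fᵢ = ℘ᵢ - 1/z² and d = f₁ - f₂, subtract the two cubic equations, factor both sides and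
  -- cancel z². Here A(0) = -4 and B(0) = 12, so n A(0) = B(0) would force n = -3.
  have hzero : ∀ᶠ z in 𝓝 (0 : ℂ), f₁ z - f₂ z = 0 := by
    refine AnalyticAt.eventually_eq_zero_of_mul_deriv_eq (a1.sub a2)
      (A := fun z => (z ^ 3 * deriv f₁ z - 2) + (z ^ 3 * deriv f₂ z - 2))
      (B := fun z => 4 * ((z ^ 2 * f₁ z + 1) ^ 2 + (z ^ 2 * f₁ z + 1) * (z ^ 2 * f₂ z + 1) +
        (z ^ 2 * f₂ z + 1) ^ 2) - L.g₂ * z ^ 4) ?_ ?_ ?_ ?_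
    · have := a1.deriv.continuousAt
      have := a2.deriv.continuousAt
      fun_prop
    · have := a1.continuousAt
      have := a2.continuousAt
      fun_prop
    · intro n hn
      norm_num at hn
      have h5 : ((n * 4 + 12 : ℕ) : ℂ) = 0 := by push_cast; linear_combination -hn
      rw [Nat.cast_eq_zero] at h5
      omega
    · have e1 := a1.eventually_analyticAt.filter_mono (nhdsWithin_le_nhds (s := {0}ᶜ))
      have e2 := a2.eventually_analyticAt.filter_mono (nhdsWithin_le_nhds (s := {0}ᶜ))
      filter_upwards [q L, q M, e1, e2, self_mem_nhdsWithin] with z q1 q2 e1 e2 hz0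
      rw [deriv_fun_sub e1.differentiableAt e2.differentiableAt]
      have hz0' : z ≠ 0 := hz0
      rw [← h2, ← h3] at q2
      apply mul_left_cancel₀ (pow_ne_zero 2 hz0')
      linear_combination q1 - q2
  filter_upwards [hzero.filter_mono (nhdsWithin_le_nhds (s := {0}ᶜ))] with z hz
  rw [p, p, show L.weierstrassPExcept 0 z = M.weierstrassPExcept 0 z from sub_eq_zero.1 hz]

/-- A lattice is determined by its invariants `g₂` and `g₃`. -/
theorem lattice_eq_of_g_eq {M : PeriodPair} (h2 : L.g₂ = M.g₂) (h3 : L.g₃ = M.g₃) :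
    L.lattice = M.lattice :=
  le_antisymm (lattice_le_of_weierstrassP_eventuallyEq (weierstrassP_eventuallyEq_of_g_eq h2 h3))
    (lattice_le_of_weierstrassP_eventuallyEq
      (weierstrassP_eventuallyEq_of_g_eq h2.symm h3.symm))

end PeriodPair

/-! ### Homothety, complex conjugation and the j-invariant -/

namespace PeriodPair

open ComplexConjugate

/-- The image of a pair of periods under an `ℝ`-linear automorphism of `ℂ`. -/
noncomputable def mapEquiv (L : PeriodPair) (e : ℂ ≃ₗ[ℝ] ℂ) : PeriodPair where
  ω₁ := e L.ω₁
  ω₂ := e L.ω₂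
  indep := by
    have h : ![e L.ω₁, e L.ω₂] = e.toLinearMap ∘ ![L.ω₁, L.ω₂] := by
      ext i
      fin_cases i <;> rfl
    rw [h]
    exact L.indep.map' e.toLinearMap e.ker

variable (L : PeriodPair)

theorem mapEquiv_lattice (e : ℂ ≃ₗ[ℝ] ℂ) :
    (L.mapEquiv e).lattice = L.lattice.map (e.toLinearMap.restrictScalars ℤ) := by
  rw [lattice, lattice, Submodule.map_span, Set.image_pair]
  rfl

theorem mem_mapEquiv_lattice {e : ℂ ≃ₗ[ℝ] ℂ} {z : ℂ} :
    z ∈ (L.mapEquiv e).lattice ↔ e.symm z ∈ L.lattice := by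
  rw [mapEquiv_lattice]
  constructor
  · rintro ⟨w, hw, rfl⟩
    simpa using hw
  · intro h
    exact ⟨_, h, by simp⟩

theorem G_mapEquiv (e : ℂ ≃ₗ[ℝ] ℂ) (n : ℕ) :
    (L.mapEquiv e).G n = ∑' l : L.lattice, (e l ^ n)⁻¹ := by
  rw [G]
  refine (Equiv.tsum_eq (e.toEquiv.subtypeEquiv fun z => ?_)
    (fun l : (L.mapEquiv e).lattice => ((l : ℂ) ^ n)⁻¹)).symm
  simp [mem_mapEquiv_lattice]

theorem G_scale (c : ℂˣ) (n : ℕ) :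
    (L.mapEquiv (DistribMulAction.toLinearEquiv ℝ ℂ c)).G n = ((c : ℂ) ^ n)⁻¹ * L.G n := by
  rw [G_mapEquiv, G, ← tsum_mul_left]
  congr with l
  simp [Units.smul_def, mul_pow, mul_comm]

theorem G_conj (n : ℕ) :
    (L.mapEquiv Complex.conjAe.toLinearEquiv).G n = conj (L.G n) := by
  rw [G_mapEquiv, G, Complex.conj_tsum]
  congr with l
  simp

theorem latticeJ_lattice : latticeJ L.lattice.toAddSubgroup =
    1728 * (L.g₂ ^ 3 / (L.g₂ ^ 3 - 27 * L.g₃ ^ 2)) := by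
  rw [latticeJ, latticeG2_eq, latticeG3_eq]

theorem latticeJ_scale (c : ℂˣ) :
    latticeJ (L.mapEquiv (DistribMulAction.toLinearEquiv ℝ ℂ c)).lattice.toAddSubgroup =
      latticeJ L.lattice.toAddSubgroup := by
  rw [latticeJ_lattice, latticeJ_lattice]
  simp only [g₂, g₃, G_scale]
  have hc := c.ne_zero
  have h : (60 * (((c : ℂ) ^ 4)⁻¹ * L.G 4)) ^ 3 = ((c : ℂ) ^ 12)⁻¹ * (60 * L.G 4) ^ 3 := by
    field_simp
  have h' : (140 * (((c : ℂ) ^ 6)⁻¹ * L.G 6)) ^ 2 = ((c : ℂ) ^ 12)⁻¹ * (140 * L.G 6) ^ 2 := by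
    field_simp
  rw [h, h', mul_left_comm, ← mul_sub, mul_div_mul_left _ _ (inv_ne_zero (pow_ne_zero _ hc))]

theorem latticeJ_conj :
    latticeJ (L.mapEquiv Complex.conjAe.toLinearEquiv).lattice.toAddSubgroup =
      conj (latticeJ L.lattice.toAddSubgroup) := by
  rw [latticeJ_lattice, latticeJ_lattice]
  simp only [g₂, g₃, G_conj]
  simp [Complex.conj_ofNat]

variable {L} {M : PeriodPair}

/-- Lattices with the same `j`-invariant are homothetic. -/
theorem exists_scale_of_latticeJ_eq
    (h : latticeJ L.lattice.toAddSubgroup = latticeJ M.lattice.toAddSubgroup) :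
    ∃ c : ℂˣ, (L.mapEquiv (DistribMulAction.toLinearEquiv ℝ ℂ c)).lattice = M.lattice := by
  rw [latticeJ_lattice, latticeJ_lattice] at h
  have hL := L.g₂_pow_three_sub_ne_zero
  have hM := M.g₂_pow_three_sub_ne_zero
  have key : L.g₂ ^ 3 * M.g₃ ^ 2 = M.g₂ ^ 3 * L.g₃ ^ 2 := by
    have h1 := mul_left_cancel₀ (by norm_num) h
    rw [div_eq_div_iff hL hM] at h1
    linear_combination (-1 / 27) * h1
  -- Scaling by μ⁻¹ multiplies g₂ by μ⁴ and g₃ by μ⁶.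
  suffices ∃ μ : ℂ, μ ≠ 0 ∧ M.g₂ = μ ^ 4 * L.g₂ ∧ M.g₃ = μ ^ 6 * L.g₃ by
    obtain ⟨μ, hμ, h2, h3⟩ := this
    refine ⟨(Units.mk0 μ hμ)⁻¹, lattice_eq_of_g_eq ?_ ?_⟩
    · rw [h2]; simp only [g₂, G_scale]; simp; ring
    · rw [h3]; simp only [g₃, G_scale]; simp; ring
  by_cases hL2 : L.g₂ = 0
  · have hL3 : L.g₃ ≠ 0 := by rintro h0; simp [h0, hL2] at hL
    have hM2 : M.g₂ = 0 := by simpa [hL2, hL3] using key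
    have hM3 : M.g₃ ≠ 0 := by rintro h0; simp [h0, hM2] at hM
    obtain ⟨μ, hμ⟩ := IsAlgClosed.exists_pow_nat_eq (M.g₃ / L.g₃) (n := 6) (by norm_num)
    refine ⟨μ, ?_, by simp [hL2, hM2], by rw [hμ]; field_simp⟩
    rintro rfl
    exact div_ne_zero hM3 hL3 (by simpa using hμ.symm)
  have hM2 : M.g₂ ≠ 0 := by
    intro h0
    have hM3 : M.g₃ ≠ 0 := by rintro h1; simp [h0, h1] at hM
    simp [h0, hL2, hM3] at key
  by_cases hL3 : L.g₃ = 0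
  · have hM3 : M.g₃ = 0 := by simpa [hL2, hL3] using key
    obtain ⟨μ, hμ⟩ := IsAlgClosed.exists_pow_nat_eq (M.g₂ / L.g₂) (n := 4) (by norm_num)
    refine ⟨μ, ?_, by rw [hμ]; field_simp, by simp [hL3, hM3]⟩
    rintro rfl
    exact div_ne_zero hM2 hL2 (by simpa using hμ.symm)
  have hM3 : M.g₃ ≠ 0 := by
    intro h0
    simp [h0, hM2, hL3] at key
  -- Dividing the two required equations forces this value of μ²; `key` makes it sufficient.
  obtain ⟨μ, hμ⟩ := IsAlgClosed.exists_pow_nat_eq ((M.g₃ * L.g₂) / (M.g₂ * L.g₃)) (n := 2)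
    (by norm_num)
  refine ⟨μ, ?_, ?_, ?_⟩
  · rintro rfl
    exact div_ne_zero (mul_ne_zero hM3 hL2) (mul_ne_zero hM2 hL3) (by simpa using hμ.symm)
  · rw [show μ ^ 4 = (μ ^ 2) ^ 2 by ring, hμ]
    field_simp
    linear_combination -key
  · rw [show μ ^ 6 = (μ ^ 2) ^ 3 by ring, hμ]
    field_simp
    linear_combination -key

-- j is real iff L and L̄ have the same j, hence iff they are homothetic; c is the inverse of the
-- factor taking L to L̄.
variable (L) in
theorem exists_latticeJ_eq_ofReal_iff :
    (∃ r : ℝ, latticeJ L.lattice.toAddSubgroup = r) ↔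
      ∃ c : ℂ, c ≠ 0 ∧ ∀ z, conj z ∈ L.lattice ↔ c * z ∈ L.lattice := by
  have h1 : (∃ r : ℝ, latticeJ L.lattice.toAddSubgroup = r) ↔
      latticeJ L.lattice.toAddSubgroup =
        latticeJ (L.mapEquiv Complex.conjAe.toLinearEquiv).lattice.toAddSubgroup := by
    rw [latticeJ_conj, eq_comm, Complex.conj_eq_iff_real]
  have h2 : ∀ c : ℂˣ, (L.mapEquiv (DistribMulAction.toLinearEquiv ℝ ℂ c)).lattice =
      (L.mapEquiv Complex.conjAe.toLinearEquiv).lattice ↔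
      ∀ z, conj z ∈ L.lattice ↔ (c⁻¹ : ℂ) * z ∈ L.lattice := by
    intro c
    rw [SetLike.ext_iff]
    refine forall_congr' fun z => ?_
    rw [mem_mapEquiv_lattice, mem_mapEquiv_lattice, iff_comm]
    have hz : Complex.conjAe.toLinearEquiv.symm z = conj z := rfl
    rw [hz]
    simp only [DistribMulAction.toLinearEquiv_symm_apply, Units.smul_def, Units.val_inv_eq_inv_val,
      smul_eq_mul]
    exact iff_comm
  rw [h1]
  constructor
  · intro h
    obtain ⟨c, hc⟩ := exists_scale_of_latticeJ_eq h
    exact ⟨(c : ℂ)⁻¹, inv_ne_zero c.ne_zero, (h2 c).1 hc⟩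
  · rintro ⟨c, hc0, hc⟩
    rw [← (h2 (Units.mk0 c hc0)⁻¹).2 (by simpa using hc), latticeJ_scale]

end PeriodPair

/-! ### Proper ideals of quadratic orders -/

theorem exists_conj_ringHom {K : Type*} [Field K] [NumberField K]
    [Algebra.IsQuadraticExtension ℚ K] [NumberField.IsTotallyComplex K] (φ : K →+* ℂ) :
    ∃ σ : K →+* K, ∀ x, φ (σ x) = starRingEnd ℂ (φ x) := by
  have : NumberField.IsCMField K := NumberField.IsCMField.ofCMExtension ℚ K
  exact ⟨(NumberField.IsCMField.complexConj K : K →+* K),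
    NumberField.IsCMField.complexEmbedding_complexConj K φ⟩

open Module in
theorem FractionalIdeal.exists_int_basis {K : Type*} [Field K] [NumberField K]
    [Algebra.IsQuadraticExtension ℚ K] (𝒪 : Subring K) [h𝒪 : IsNumberFieldOrder 𝒪]
    {𝔞 : FractionalIdeal 𝒪⁰ K} (h𝔞 : 𝔞 ≠ 0) :
    ∃ α β : K, (∀ x, x ∈ 𝔞 ↔ ∃ m n : ℤ, m * α + n * β = x) ∧ LinearIndependent ℚ ![α, β] := by
  have := h𝒪.finite
  have : IsNoetherianRing 𝒪 := IsNoetherianRing.of_finite ℤ 𝒪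
  have : Module.Finite 𝒪 (𝔞 : Submodule 𝒪 K) := by
    rw [Module.Finite.iff_fg]
    exact FractionalIdeal.fg_of_isNoetherianRing le_rfl 𝔞
  have : Module.Finite ℤ (𝔞 : Submodule 𝒪 K) := Module.Finite.trans 𝒪 _
  obtain ⟨y, hy, hy0⟩ := exists_ne_zero_mem_isInteger h𝔞 |> fun ⟨y, hy0, hy⟩ =>
    (⟨algebraMap 𝒪 K y, hy, by simpa using hy0⟩ : ∃ y : K, y ∈ 𝔞 ∧ y ≠ 0)
  let b := Module.finBasis ℤ (𝔞 : Submodule 𝒪 K)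
  let v : Fin (finrank ℤ (𝔞 : Submodule 𝒪 K)) → K := fun i => (b i : K)
  have hv : ∀ x, x ∈ 𝔞 ↔ x ∈ Submodule.span ℤ (Set.range v) := by
    intro x
    have h1 : Set.range v = ((𝔞 : Submodule 𝒪 K).subtype.restrictScalars ℤ) '' Set.range b := by
      rw [← Set.range_comp]; rfl
    rw [h1, ← Submodule.map_span, b.span_eq]
    simp
  have hli : LinearIndependent ℚ v := by
    rw [← LinearIndependent.iff_fractionRing (R := ℤ)]
    exact b.linearIndependent.map' ((𝔞 : Submodule 𝒪 K).subtype.restrictScalars ℤ)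
      (LinearMap.ker_eq_bot.2 Subtype.val_injective)
  -- For a nonzero y ∈ 𝔞, some multiple n(x/y) lies in 𝒪, so nx ∈ 𝔞.
  have hsp : ⊤ ≤ Submodule.span ℚ (Set.range v) := by
    intro x _
    obtain ⟨n, hn, hx⟩ := IsNumberFieldOrder.exists_nat_mul_mem 𝒪 (x / y)
    have hm : (n : K) * x ∈ 𝔞 := by
      have := (𝔞 : Submodule 𝒪 K).smul_mem ⟨_, hx⟩ hy
      rw [FractionalIdeal.mem_coe] at this
      convert this using 1
      rw [Subring.smul_def, smul_eq_mul]
      field_simp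
    have h2 := Submodule.span_subset_span ℤ ℚ _ ((hv _).1 hm)
    have h3 := Submodule.smul_mem _ ((n : ℚ)⁻¹) h2
    convert h3 using 1
    rw [Algebra.smul_def]
    have : (n : K) ≠ 0 := Nat.cast_ne_zero.2 hn
    simp [this]
  have hrank : finrank ℤ (𝔞 : Submodule 𝒪 K) = 2 := by
    have := finrank_eq_card_basis (Basis.mk hli hsp)
    rw [Algebra.IsQuadraticExtension.finrank_eq_two ℚ K, Fintype.card_fin] at this
    exact this.symm
  refine ⟨v (finCongr hrank.symm 0), v (finCongr hrank.symm 1), ?_, ?_⟩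
  · intro x
    have h1 : Set.range v = {v (finCongr hrank.symm 0), v (finCongr hrank.symm 1)} := by
      rw [← (finCongr hrank.symm).surjective.range_comp v]
      ext z
      simp only [Set.mem_range, Function.comp_apply, Fin.exists_fin_two, Set.mem_insert_iff,
        Set.mem_singleton_iff, eq_comm]
    rw [hv, h1, Submodule.mem_span_pair]
    simp
  · have h1 := hli.comp _ (finCongr hrank.symm).injective
    convert h1 using 1
    ext i
    fin_cases i <;> rfl

/-- Two `ℚ`-linearly independent elements of a quadratic field are related by a primitive
integral binary quadratic form. -/
theorem exists_primitive_form {K : Type*} [Field K] [CharZero K]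
    [Algebra.IsQuadraticExtension ℚ K] {α β : K} (h : LinearIndependent ℚ ![α, β]) :
    ∃ a b c u v w : ℤ, a ≠ 0 ∧ u * a + v * b + w * c = 1 ∧
      a * β ^ 2 + b * α * β + c * α ^ 2 = 0 := by
  have hα : α ≠ 0 := h.ne_zero 0
  have hfin := Algebra.IsQuadraticExtension.finrank_eq_two ℚ K
  have hsp := h.span_eq_top_of_card_eq_finrank (by simp [hfin])
  have hmem : β ^ 2 / α ∈ Submodule.span ℚ (Set.range ![α, β]) := by rw [hsp]; trivial
  rw [Matrix.range_cons_cons_empty, Submodule.mem_span_pair] at hmem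
  obtain ⟨r, s, hrs⟩ := hmem
  simp only [Algebra.smul_def, eq_ratCast] at hrs
  have hrs' : β ^ 2 = r * α ^ 2 + s * α * β := by
    field_simp at hrs
    linear_combination -hrs
  have hrd : (r.den : K) * r = r.num := by
    exact_mod_cast congrArg (fun q : ℚ => (q : K)) (Rat.den_mul_eq_num r)
  have hsd : (s.den : K) * s = s.num := by
    exact_mod_cast congrArg (fun q : ℚ => (q : K)) (Rat.den_mul_eq_num s)
  set A : ℤ := r.den * s.den with hA
  set B : ℤ := -(r.den * s.num) with hB
  set C : ℤ := -(s.den * r.num) with hC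
  have hA0 : A ≠ 0 := by simp [hA]
  have hABC : A * β ^ 2 + B * α * β + C * α ^ 2 = 0 := by
    simp only [hA, hB, hC]
    push_cast
    linear_combination (r.den * s.den : K) * hrs' + s.den * α ^ 2 * hrd + r.den * α * β * hsd
  -- g is a gcd of A, B, C; dividing by it makes the form primitive, with Bézout coefficients u, v,
  -- w.
  set g : ℤ := Submodule.IsPrincipal.generator (Ideal.span {A, B, C})
  have hg : Ideal.span {g} = Ideal.span {A, B, C} := Ideal.span_singleton_generator _
  obtain ⟨a, ha⟩ := Ideal.mem_span_singleton.1
    (hg ▸ Ideal.subset_span (by simp) : A ∈ Ideal.span {g})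
  obtain ⟨b, hb⟩ := Ideal.mem_span_singleton.1
    (hg ▸ Ideal.subset_span (by simp) : B ∈ Ideal.span {g})
  obtain ⟨c, hc⟩ := Ideal.mem_span_singleton.1
    (hg ▸ Ideal.subset_span (by simp) : C ∈ Ideal.span {g})
  have hgm : g ∈ Ideal.span {A, B, C} := hg ▸ Ideal.mem_span_singleton_self g
  obtain ⟨u, v, w, huvw⟩ := Submodule.mem_span_triple.1 hgm
  have hg0 : g ≠ 0 := by rintro h0; simp [h0] at ha; exact hA0 ha
  have hgK : (g : K) ≠ 0 := Int.cast_ne_zero.2 hg0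
  refine ⟨a, b, c, u, v, w, ?_, ?_, ?_⟩
  · rintro rfl; simp at ha; exact hA0 ha
  · apply mul_left_cancel₀ hg0
    simp only [smul_eq_mul] at huvw
    rw [ha, hb, hc] at huvw
    linear_combination huvw
  · apply mul_left_cancel₀ hgK
    rw [ha, hb, hc] at hABC
    push_cast at hABC
    linear_combination hABC

section

variable {K : Type*} [Field K] [CharZero K] {𝒪 : Subring K} {𝔞 : FractionalIdeal 𝒪⁰ K} {α β : K}
  {σ : K →+* K}

/-- Multiplication by x has an integer matrix on α, β, and σ x is its trace minus x. -/
theorem Subring.map_mem_of_int_basis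
    (hmem : ∀ x, x ∈ 𝔞 ↔ ∃ m n : ℤ, m * α + n * β = x) (hdet : α * σ β - β * σ α ≠ 0) {x : K}
    (hx : x ∈ 𝒪) : σ x ∈ 𝒪 := by
  have hmul : ∀ y ∈ 𝔞, x * y ∈ 𝔞 := fun y hy => (𝔞 : Submodule 𝒪 K).smul_mem ⟨x, hx⟩ hy
  obtain ⟨m, n, h1⟩ := (hmem _).1 (hmul α ((hmem _).2 ⟨1, 0, by simp⟩))
  obtain ⟨k, l, h2⟩ := (hmem _).1 (hmul β ((hmem _).2 ⟨0, 1, by simp⟩))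
  have h1' := congrArg σ h1
  have h2' := congrArg σ h2
  simp only [map_add, map_mul, map_intCast] at h1' h2'
  have htr : σ x = ((m + l : ℤ) : K) - x := by
    apply mul_left_cancel₀ hdet
    push_cast
    linear_combination β * h1' - α * h2' - σ β * h1 + σ α * h2
  rw [htr]
  exact 𝒪.sub_mem (intCast_mem _ _) hx

-- Put κ = ασ(α)/a and θ = aβ/α. The products of α, β with σα, σβ are κ times a, σθ, θ, c, all in 𝒪,
-- and primitivity of the form gives back κ.
open FractionalIdeal in
theorem exists_conj_ideal_mul_eq_spanSingleton [IsFractionRing 𝒪 K]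
    (h𝔞 : IsProperFractionalIdeal 𝔞)
    (hmem : ∀ x, x ∈ 𝔞 ↔ ∃ m n : ℤ, m * α + n * β = x) (hdet : α * σ β - β * σ α ≠ 0)
    (hσ : ∀ x, σ (σ x) = x) {a b c u v w : ℤ} (ha : a ≠ 0) (huvw : u * a + v * b + w * c = 1)
    (hform : a * β ^ 2 + b * α * β + c * α ^ 2 = 0) :
    ∃ 𝔟 : FractionalIdeal 𝒪⁰ K, (∀ x, x ∈ 𝔟 ↔ σ x ∈ 𝔞) ∧
      ∃ κ : K, κ ≠ 0 ∧ 𝔞 * 𝔟 = spanSingleton 𝒪⁰ κ := by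
  have hαm : α ∈ 𝔞 := (hmem _).2 ⟨1, 0, by simp⟩
  have hβm : β ∈ 𝔞 := (hmem _).2 ⟨0, 1, by simp⟩
  have hsmul : ∀ x ∈ 𝒪, ∀ (I : FractionalIdeal 𝒪⁰ K), ∀ y ∈ I, x * y ∈ I :=
    fun x hx I y hy => (I : Submodule 𝒪 K).smul_mem ⟨x, hx⟩ hy
  have haK : (a : K) ≠ 0 := Int.cast_ne_zero.2 ha
  have hα : α ≠ 0 := by
    rintro rfl
    have hβ : (a : K) * β ^ 2 = 0 := by simpa using hform
    have : β = 0 := by simpa [haK] using hβ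
    simp [this] at hdet
  have hσα : σ α ≠ 0 := (map_ne_zero σ).2 hα
  have hform' := congrArg σ hform
  simp only [map_add, map_mul, map_pow, map_intCast, map_zero] at hform'
  -- Vieta's formulas for β/α and its conjugate, the roots of aX² + bX + c.
  have htr : a * (α * σ β + β * σ α) = -(b * (α * σ α)) := by
    apply mul_left_cancel₀ hdet
    linear_combination α ^ 2 * hform' - (σ α) ^ 2 * hform
  have hnorm : a * (β * σ β) = c * (α * σ α) := by
    apply mul_left_cancel₀ hdet
    linear_combination α * β * hform' - σ α * σ β * hform
  -- Properness enters here: θα = aβ and θβ = -bβ - cα show θ𝔞 ⊆ 𝔞.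
  have hθ : a * β / α ∈ 𝒪 := by
    rw [← SetLike.mem_coe, ← h𝔞.2]
    intro x hx
    obtain ⟨m, n, rfl⟩ := (hmem x).1 hx
    refine (hmem _).2 ⟨-(n * c), m * a - n * b, ?_⟩
    push_cast
    field_simp
    linear_combination -n * hform
  have hθ' : a * σ β / σ α ∈ 𝒪 := by
    have := Subring.map_mem_of_int_basis hmem hdet hθ
    simpa only [map_div₀, map_mul, map_intCast] using this
  obtain ⟨𝔟, h𝔟⟩ : ∃ 𝔟 : FractionalIdeal 𝒪⁰ K, ∀ x, x ∈ 𝔟 ↔ σ x ∈ 𝔞 := by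
    refine ⟨spanSingleton 𝒪⁰ (σ α) + spanSingleton 𝒪⁰ (σ β), fun x => ⟨fun hx => ?_, fun hx => ?_⟩⟩
    · rw [← mem_coe, coe_add, Submodule.add_eq_sup, Submodule.mem_sup] at hx
      obtain ⟨y, hy, z, hz, rfl⟩ := hx
      rw [mem_coe, mem_spanSingleton] at hy hz
      obtain ⟨p, rfl⟩ := hy
      obtain ⟨q, rfl⟩ := hz
      simp only [Subring.smul_def, smul_eq_mul, map_add, map_mul, hσ]
      exact (𝔞 : Submodule 𝒪 K).add_mem
        (hsmul _ (Subring.map_mem_of_int_basis hmem hdet p.2) 𝔞 _ hαm)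
        (hsmul _ (Subring.map_mem_of_int_basis hmem hdet q.2) 𝔞 _ hβm)
    · obtain ⟨m, n, hmn⟩ := (hmem _).1 hx
      have hx' : x = m * σ α + n * σ β := by
        rw [← hσ x, ← hmn]; simp
      rw [hx', ← mem_coe, coe_add, Submodule.add_eq_sup]
      exact Submodule.add_mem_sup
        (hsmul _ (intCast_mem _ _) _ _ (mem_spanSingleton_self _ _))
        (hsmul _ (intCast_mem _ _) _ _ (mem_spanSingleton_self _ _))
  have hσαm : σ α ∈ 𝔟 := (h𝔟 _).2 (by rwa [hσ])
  have hσβm : σ β ∈ 𝔟 := (h𝔟 _).2 (by rwa [hσ])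
  refine ⟨𝔟, h𝔟, α * σ α / a, div_ne_zero (mul_ne_zero hα hσα) haK, le_antisymm ?_ ?_⟩
  · have hκ : ∀ x ∈ 𝒪, x * (α * σ α / a) ∈ spanSingleton 𝒪⁰ (α * σ α / a) :=
      fun x hx => (mem_spanSingleton _).2 ⟨⟨x, hx⟩, rfl⟩
    have g1 : α * σ α ∈ spanSingleton 𝒪⁰ (α * σ α / a) := by
      convert hκ a (intCast_mem _ _) using 1
      field_simp
    have g2 : α * σ β ∈ spanSingleton 𝒪⁰ (α * σ α / a) := by
      convert hκ _ hθ' using 1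
      field_simp
    have g3 : β * σ α ∈ spanSingleton 𝒪⁰ (α * σ α / a) := by
      convert hκ _ hθ using 1
      field_simp
    have g4 : β * σ β ∈ spanSingleton 𝒪⁰ (α * σ α / a) := by
      convert hκ c (intCast_mem _ _) using 1
      field_simp
      linear_combination hnorm
    rw [mul_le]
    intro x hx y hy
    obtain ⟨m, n, rfl⟩ := (hmem _).1 hx
    obtain ⟨k, l, hkl⟩ := (hmem _).1 ((h𝔟 _).1 hy)
    have hy' : y = k * σ α + l * σ β := by
      rw [← hσ y, ← hkl]; simp
    have hz : ∀ (i j : ℤ) (x), x ∈ spanSingleton 𝒪⁰ (α * σ α / a) →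
        (i * j * x : K) ∈ spanSingleton 𝒪⁰ (α * σ α / a) := fun i j x hx =>
      hsmul _ (𝒪.mul_mem (intCast_mem _ _) (intCast_mem _ _)) _ _ hx
    have hadd := fun x y => (spanSingleton 𝒪⁰ (α * σ α / a) : Submodule 𝒪 K).add_mem (x := x) (y := y)
    have := hadd _ _ (hadd _ _ (hz m k _ g1) (hz m l _ g2)) (hadd _ _ (hz n k _ g3) (hz n l _ g4))
    rw [mem_coe] at this
    convert this using 1
    rw [hy']
    ring
  · rw [spanSingleton_le_iff_mem]
    have hadd := fun x y => (𝔞 * 𝔟 : FractionalIdeal 𝒪⁰ K).coeToSubmodule.add_mem (x := x) (y := y)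
    have hz : ∀ (i : ℤ) (x), x ∈ 𝔞 * 𝔟 → (i * x : K) ∈ 𝔞 * 𝔟 := fun i x hx =>
      hsmul _ (intCast_mem _ _) _ _ hx
    have := hadd _ _ (hadd _ _ (hz u _ (mul_mem_mul hαm hσαm))
      (hz (-v) _ (hadd _ _ (mul_mem_mul hαm hσβm) (mul_mem_mul hβm hσαm))))
      (hz w _ (mul_mem_mul hβm hσβm))
    rw [mem_coe] at this
    convert this using 1
    have huvw' : (u * a + v * b + w * c : K) = 1 := by exact_mod_cast huvw
    field_simp
    push_cast
    linear_combination -(α * σ α) * huvw' + v * htr - w * hnorm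

end

/-! ### Classes of order at most two and real j -/

/-- `orderOf` is 0 on elements of infinite order, so finiteness must be required separately. -/
theorem isOfFinOrder_and_orderOf_le_two_iff {G : Type*} [Monoid G] (g : G) :
    IsOfFinOrder g ∧ orderOf g ≤ 2 ↔ g ^ 2 = 1 := by
  constructor
  · rintro ⟨h1, h2⟩
    have h3 := h1.orderOf_pos
    rw [← orderOf_dvd_iff_pow_eq_one]
    interval_cases orderOf g <;> norm_num
  · intro h
    exact ⟨isOfFinOrder_iff_pow_eq_one.2 ⟨2, two_pos, h⟩, orderOf_le_of_pow_eq_one two_pos h⟩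

-- 𝔟 represents the inverse class of `u`, so the square is trivial iff 𝔟 and `u` are in the same
-- class.
open FractionalIdeal in
theorem ClassGroup.mk_sq_eq_one_iff {R K : Type*} [CommRing R] [IsDomain R] [Field K] [Algebra R K]
    [IsFractionRing R K] {u : (FractionalIdeal R⁰ K)ˣ} {𝔟 : FractionalIdeal R⁰ K} {κ : K}
    (hκ : κ ≠ 0) (h : (u : FractionalIdeal R⁰ K) * 𝔟 = spanSingleton R⁰ κ) :
    ClassGroup.mk K u ^ 2 = 1 ↔ ∃ y : K, y ≠ 0 ∧ 𝔟 = spanSingleton R⁰ y * u := by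
  rw [← map_pow, ClassGroup.mk_eq_one_iff, isPrincipal_iff, Units.val_pow_eq_pow_val]
  constructor
  · rintro ⟨x, hx⟩
    have hx0 : x ≠ 0 := by
      rintro rfl
      rw [spanSingleton_zero] at hx
      exact (u ^ 2).ne_zero (by simpa using hx)
    refine ⟨κ / x, div_ne_zero hκ hx0, ?_⟩
    apply u.isUnit.mul_left_cancel
    rw [h, mul_left_comm, ← pow_two, hx, spanSingleton_mul_spanSingleton, div_mul_cancel₀ _ hx0]
  · rintro ⟨y, hy, rfl⟩
    refine ⟨y⁻¹ * κ, ?_⟩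
    rw [← spanSingleton_mul_spanSingleton, ← h, mul_left_comm _ (spanSingleton R⁰ y), ← mul_assoc,
      spanSingleton_mul_spanSingleton, inv_mul_cancel₀ hy, spanSingleton_one, one_mul, pow_two]

section

variable {K : Type*} [Field K] {𝒪 : Subring K}

theorem mem_idealLattice {φ : K →+* ℂ} {𝔞 : FractionalIdeal 𝒪⁰ K} {z : ℂ} :
    z ∈ idealLattice φ 𝔞 ↔ ∃ x ∈ 𝔞, φ x = z := Iff.rfl

theorem map_mem_idealLattice {φ : K →+* ℂ} {𝔞 : FractionalIdeal 𝒪⁰ K} {x : K} :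
    φ x ∈ idealLattice φ 𝔞 ↔ x ∈ 𝔞 := by
  rw [mem_idealLattice]
  exact ⟨fun ⟨y, hy, hxy⟩ => φ.injective hxy ▸ hy, fun hx => ⟨x, hx, rfl⟩⟩

open FractionalIdeal in
/-- The lattice of `𝔞` is homothetic to its complex conjugate exactly when `𝔞` and its conjugate
differ by a principal fractional ideal. -/
theorem idealLattice_homothetic_conj_iff [IsFractionRing 𝒪 K] {φ : K →+* ℂ} {σ : K →+* K}
    (hσ : ∀ x, φ (σ x) = starRingEnd ℂ (φ x)) {𝔞 𝔟 : FractionalIdeal 𝒪⁰ K} {x₀ : K}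
    (hx₀ : x₀ ≠ 0) (hx₀' : x₀ ∈ 𝔞) (h𝔟 : ∀ x, x ∈ 𝔟 ↔ σ x ∈ 𝔞) :
    (∃ c : ℂ, c ≠ 0 ∧ ∀ z, starRingEnd ℂ z ∈ idealLattice φ 𝔞 ↔ c * z ∈ idealLattice φ 𝔞) ↔
      ∃ y : K, y ≠ 0 ∧ 𝔟 = spanSingleton 𝒪⁰ y * 𝔞 := by
  have hσσ : ∀ x, σ (σ x) = x := fun x => φ.injective (by rw [hσ, hσ, Complex.conj_conj])
  have hmem : ∀ y : K, y ≠ 0 → (𝔟 = spanSingleton 𝒪⁰ y * 𝔞 ↔ ∀ x, σ x ∈ 𝔞 ↔ y⁻¹ * x ∈ 𝔞) := by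
    intro y hy
    rw [SetLike.ext_iff]
    refine forall_congr' fun x => ?_
    rw [h𝔟, mem_singleton_mul]
    refine iff_congr Iff.rfl ⟨?_, fun h => ⟨_, h, by field_simp⟩⟩
    rintro ⟨z, hz, rfl⟩
    rwa [inv_mul_cancel_left₀ hy]
  constructor
  · rintro ⟨c, hc, h⟩
    -- Testing z = φ(σ x₀), whose conjugate φ(x₀) is in the lattice, shows that c ∈ φ(K).
    have h1 : starRingEnd ℂ (φ (σ x₀)) ∈ idealLattice φ 𝔞 := by
      rw [← hσ, hσσ]
      exact map_mem_idealLattice.2 hx₀'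
    obtain ⟨k, hk, hkc⟩ := (h _).1 h1
    have hk' : φ k = c * φ (σ x₀) := hkc
    have hs : φ (σ x₀) ≠ 0 := by simpa using hx₀
    have hc' : c = φ (k / σ x₀) := by rw [map_div₀, hk']; field_simp
    have hk0 : k / σ x₀ ≠ 0 := by rintro h0; rw [h0, map_zero] at hc'; exact hc hc'
    refine ⟨(k / σ x₀)⁻¹, inv_ne_zero hk0, (hmem _ (inv_ne_zero hk0)).2 fun x => ?_⟩
    have := h (φ x)
    rw [inv_inv]
    rwa [← hσ, hc', ← map_mul, map_mem_idealLattice, map_mem_idealLattice] at this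
  · rintro ⟨y, hy, h⟩
    rw [hmem y hy] at h
    have hφy : φ y ≠ 0 := (map_ne_zero φ).2 hy
    have hy' : φ y⁻¹ ≠ 0 := by simpa using hy
    refine ⟨φ y⁻¹, hy', fun z => ⟨?_, ?_⟩⟩
    · rintro ⟨x, hx, hxz⟩
      have hxz' : φ x = starRingEnd ℂ z := hxz
      have hz : z = φ (σ x) := by rw [hσ, hxz', Complex.conj_conj]
      rw [hz, ← map_mul, map_mem_idealLattice, ← h, hσσ]
      exact hx
    · rintro ⟨x, hx, hxz⟩
      have hxz' : φ x = φ y⁻¹ * z := hxz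
      have hz : z = φ (y * x) := by rw [map_mul, hxz', map_inv₀, mul_inv_cancel_left₀ hφy]
      rw [hz, ← hσ, map_mem_idealLattice, h, inv_mul_cancel_left₀ hy]
      exact hx

end

/-- `ClassGroup 𝒪` is the group of invertible fractional `𝒪`-ideals modulo the principal ones.
The conclusion says that `𝔞` is invertible, so that it has a class, and that `j(𝔞)` is real if and
only if this class has order `1` or `2`. -/
theorem proposition2p3 {K : Type*} [Field K] [NumberField K]
    [Algebra.IsQuadraticExtension ℚ K] [NumberField.IsTotallyComplex K]
    (φ : K →+* ℂ) (𝒪 : Subring K) [IsNumberFieldOrder 𝒪]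
    (𝔞 : FractionalIdeal 𝒪⁰ K) (h𝔞 : IsProperFractionalIdeal 𝔞) :
    ∃ u : (FractionalIdeal 𝒪⁰ K)ˣ, (u : FractionalIdeal 𝒪⁰ K) = 𝔞 ∧
      ((∃ r : ℝ, latticeJ (idealLattice φ 𝔞) = (r : ℂ)) ↔
        IsOfFinOrder (ClassGroup.mk K u) ∧ orderOf (ClassGroup.mk K u) ≤ 2) := by
  obtain ⟨σ, hσ⟩ := exists_conj_ringHom φ
  have hσσ : ∀ x, σ (σ x) = x := fun x => φ.injective (by rw [hσ, hσ, Complex.conj_conj])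
  obtain ⟨α, β, hmem, hli⟩ := FractionalIdeal.exists_int_basis 𝒪 h𝔞.1
  have hα : α ≠ 0 := hli.ne_zero 0
  have hαm : α ∈ 𝔞 := (hmem _).2 ⟨1, 0, by simp⟩
  -- Otherwise σ fixes β/α, hence all of K, and φ would be a real embedding.
  have hdet : α * σ β - β * σ α ≠ 0 := by
    intro hdet
    have hsp := hli.span_eq_top_of_card_eq_finrank
      (by simp [Algebra.IsQuadraticExtension.finrank_eq_two ℚ K])
    refine NumberField.IsTotallyComplex.complexEmbedding_not_isReal φ ?_
    rw [NumberField.ComplexEmbedding.isReal_iff]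
    ext x
    have hx : x * α ∈ Submodule.span ℚ (Set.range ![α, β]) := by rw [hsp]; trivial
    rw [Matrix.range_cons_cons_empty, Submodule.mem_span_pair] at hx
    obtain ⟨r, s, hrs⟩ := hx
    simp only [Algebra.smul_def, eq_ratCast] at hrs
    have hrs' := congrArg σ hrs
    simp only [map_add, map_mul, map_ratCast] at hrs'
    have hσα : σ α ≠ 0 := (map_ne_zero σ).2 hα
    have hfix : σ x = x := by
      apply mul_left_cancel₀ (mul_ne_zero hα hσα)
      linear_combination σ α * hrs - α * hrs' + s * hdet
    rw [NumberField.ComplexEmbedding.conjugate_coe_eq, ← hσ, hfix]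
  obtain ⟨a, b, c, u, v, w, ha, huvw, hform⟩ := exists_primitive_form hli
  obtain ⟨𝔟, h𝔟, κ, hκ, hprod⟩ :=
    exists_conj_ideal_mul_eq_spanSingleton h𝔞 hmem hdet hσσ ha huvw hform
  have hunit : 𝔞 * (𝔟 * FractionalIdeal.spanSingleton 𝒪⁰ κ⁻¹) = 1 := by
    rw [← mul_assoc, hprod, FractionalIdeal.spanSingleton_mul_spanSingleton, mul_inv_cancel₀ hκ,
      FractionalIdeal.spanSingleton_one]
  refine ⟨Units.mkOfMulEqOne _ _ hunit, rfl, ?_⟩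
  have hindep : LinearIndependent ℝ ![φ α, φ β] := by
    rw [LinearIndependent.pair_iff]
    intro s t hst
    simp only [Complex.real_smul] at hst
    have hst' := congrArg (starRingEnd ℂ) hst
    simp only [map_add, map_mul, Complex.conj_ofReal, map_zero, ← hσ] at hst'
    have hdet' : φ α * φ (σ β) - φ β * φ (σ α) ≠ 0 := by
      simpa using (map_ne_zero φ).2 hdet
    constructor
    · have : (s : ℂ) = 0 := by
        apply mul_left_cancel₀ hdet'
        linear_combination φ (σ β) * hst - φ β * hst'
      exact_mod_cast this
    · have : (t : ℂ) = 0 := by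
        apply mul_left_cancel₀ hdet'
        linear_combination φ α * hst' - φ (σ α) * hst
      exact_mod_cast this
  let P : PeriodPair := ⟨φ α, φ β, hindep⟩
  have hP : idealLattice φ 𝔞 = P.lattice.toAddSubgroup := by
    ext z
    rw [mem_idealLattice, Submodule.mem_toAddSubgroup, PeriodPair.mem_lattice]
    constructor
    · rintro ⟨x, hx, rfl⟩
      obtain ⟨m, n, rfl⟩ := (hmem x).1 hx
      exact ⟨m, n, by simp [P]⟩
    · rintro ⟨m, n, rfl⟩
      exact ⟨m * α + n * β, (hmem _).2 ⟨m, n, rfl⟩, by simp [P]⟩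
  rw [isOfFinOrder_and_orderOf_le_two_iff,
    ClassGroup.mk_sq_eq_one_iff (𝔟 := 𝔟) hκ (by exact hprod), hP,
    P.exists_latticeJ_eq_ofReal_iff]
  simp only [← Submodule.mem_toAddSubgroup, ← hP]
  exact idealLattice_homothetic_conj_iff hσ hα hαm h𝔟
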